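/- Let the state $\omega$ be drawn from $\mu=\mathcal N(0,I_d)$ on $\mathbb R^d$. There are $n$ buyer types; type $i\in[n]$ has probability $f_i\ge 0$, with $\sum_i f_i=1$, and preference vector $\theta_i\in\mathbb R^d$; its utility from the action $a\in\mathbb R$ in the state $\omega$ is $u^i(\omega,a)=-(\theta_i^\top\omega-a)^2$. An experiment $E=(S,\pi)$ consists of a measurable space $S$ of signals and a Markov kernel $\pi(\cdot\mid\omega)$ from $\mathbb R^d$ to $S$; its value for type $i$ is $$V(E,i)=\mathbb E_{s}\Big[\max_{a\in\mathbb R}\,\mathbb E\big[u^i(\omega,a)\mid s\big]\Big],$$ where $s$ is drawn from the marginal distribution of the signal and the inner expectation is over the posterior of $\omega$ given $s$. A menu is a family of experiments with real prices. Type $i$ buys one item $(E,t)$ of the menu, with net utility $V(E,i)-t$, or buys nothing, with net utility $u^i=\max_{a}\mathbb E_{\omega\sim\mu}[u^i(\omega,a)]$ and payment $0$; its purchase is optimal if it has the largest net utility among these options. The revenue of a menu, with given optimal purchases of all types, is $\sum_i f_i\,(\text{payment of type } i)$. Let $\{v_i,t^i\}_{i\in[n]}$, with $v_i\in\mathbb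 R^d$ and $t^i\in\mathbb R$, be an optimal solution of the (nonconvex) QCQP $$\begin{array}{lll}\max\limits_{\{v_i,t^i\}} & \sum_{i\in[n]} f_i t^i & \\ \text{subject to} & (\theta_i^\top v_i)^2-t^i\ \ge\ (\theta_i^\top v_j)^2-t^j, & \forall i,j\in[n],\\ & (\theta_i^\top v_i)^2-t^i\ \ge\ 0\ \text{ and }\ \|v_i\|\le 1, & \forall i\in[n].\end{array}$$ Let $E^i$ be the experiment whose signal in the state $\omega$ is distributed as $\mathcal N(v_i^\top\omega,\,1-\|v_i\|^2)$. Then $t^i\ge 0$ for all $i$, and the menu $\{(E^i,t^i)\}_{i\in[n]}$ is revenue-maximizing: it is optimal for each type $i$ to purchase $(E^i,t^i)$ (that is, $V(E^i,i)-t^i\ge V(E^j,i)-t^j$ and $V(E^i,i)-t^i\ge u^i$ for all $i,j$), and no menu, with any optimal purchases of the types, has a larger revenue. -/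

import Mathlib

open MeasureTheory ProbabilityTheory
open scoped NNReal

universe uΩ uS uK

set_option linter.checkUnivs false

noncomputable section

/-- A statistical experiment on the state space `Ω`: a measurable space of signals and a signalling
function sending each state to a probability distribution over the signals. -/
structure Experiment (Ω : Type uΩ) [MeasurableSpace Ω] where
  Signal : Type uS
  [measurableSignal : MeasurableSpace Signal]
  kernel : Kernel Ω Signal
  [markov : IsMarkovKernel kernel]

attribute [instance] Experiment.measurableSignal Experiment.markov

/-- A menu: a family of experiments, each offered at an (expected) price. -/
structure Menu (Ω : Type uΩ) [MeasurableSpace Ω] where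
  Item : Type uK
  experiment : Item → Experiment.{uΩ, uS} Ω
  price : Item → ℝ

section Model

variable {Ω : Type uΩ} [MeasurableSpace Ω] {A : Type*}

/-- The utility of a buyer with prior `μ` and utility function `u` who gets no information:
the best expected utility of an action under the prior. -/
def baselineUtility (μ : Measure Ω) (u : Ω → A → ℝ) : ℝ :=
  ⨆ a : A, ∫ ω, u ω a ∂μ

/-- The value of an experiment: the expectation, over the signal `s` drawn from its marginal
distribution, of the best expected utility of an action under the posterior given `s`. -/
def Experiment.value [StandardBorelSpace Ω] [Nonempty Ω] (E : Experiment.{uΩ, uS} Ω)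
    (μ : Measure Ω) [IsFiniteMeasure μ] (u : Ω → A → ℝ) : ℝ :=
  ∫ s, ⨆ a : A, ∫ ω, u ω a ∂(posterior E.kernel μ s) ∂(μ.bind E.kernel)

/-- The net utility of a buyer who buys the item `k` of the menu (`some k`), or nothing (`none`). -/
def Menu.netUtility [StandardBorelSpace Ω] [Nonempty Ω] (M : Menu.{uΩ, uS, uK} Ω)
    (μ : Measure Ω) [IsFiniteMeasure μ] (u : Ω → A → ℝ) : Option M.Item → ℝ
  | none => baselineUtility μ u
  | some k => (M.experiment k).value μ u - M.price k

/-- What the seller receives for the item `k` (`some k`) or when nothing is bought (`none`). -/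
def Menu.payment (M : Menu.{uΩ, uS, uK} Ω) : Option M.Item → ℝ
  | none => 0
  | some k => M.price k

/-- The purchases `c` are optimal for the buyer: each type `i` prefers `c i` to every other item of
the menu and to buying nothing. For a menu with one item per type and `c i = some i`, these are the
incentive compatibility and individual rationality constraints. -/
def Menu.IsOptimalPurchase [StandardBorelSpace Ω] [Nonempty Ω] (M : Menu.{uΩ, uS, uK} Ω)
    (μ : Measure Ω) [IsFiniteMeasure μ] {n : ℕ} (u : Fin n → Ω → A → ℝ)
    (c : Fin n → Option M.Item) : Prop :=
  ∀ (i : Fin n) (o : Option M.Item), M.netUtility μ (u i) o ≤ M.netUtility μ (u i) (c i)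

/-- The expected revenue when type `i`, which has probability `f i`, makes the purchase `c i`. -/
def Menu.revenue (M : Menu.{uΩ, uS, uK} Ω) {n : ℕ} (f : Fin n → ℝ)
    (c : Fin n → Option M.Item) : ℝ :=
  ∑ i, f i * M.payment (c i)

end Model

/-- The menu `M`, from which type `i` purchases `c i`, is revenue-maximizing: the purchases are
optimal for the buyer, and no menu whatsoever, with any purchases that are optimal for the buyer,
has a larger expected revenue. -/
def Menu.IsRevenueMaximizing.{vΩ, vA, vS, vK, wS, wK} {Ω : Type vΩ} [MeasurableSpace Ω]
    [StandardBorelSpace Ω] [Nonempty Ω] {A : Type vA} (M : Menu.{vΩ, vS, vK} Ω)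
    (μ : Measure Ω) [IsFiniteMeasure μ] {n : ℕ} (f : Fin n → ℝ) (u : Fin n → Ω → A → ℝ)
    (c : Fin n → Option M.Item) : Prop :=
  M.IsOptimalPurchase μ u c ∧
    ∀ (M' : Menu.{vΩ, wS, wK} Ω) (c' : Fin n → Option M'.Item),
      M'.IsOptimalPurchase μ u c' → M'.revenue f c' ≤ M.revenue f c

/-- The utility `-(θᵀ ω - a)²` of the action `a` in the state `ω`. -/
def quadraticUtility {d : ℕ} (θ ω : EuclideanSpace ℝ (Fin d)) (a : ℝ) : ℝ :=
  -(inner ℝ θ ω - a) ^ 2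

theorem measurable_gaussianReal_inner {d : ℕ} (v : EuclideanSpace ℝ (Fin d)) (σ2 : ℝ≥0) :
    Measurable fun ω : EuclideanSpace ℝ (Fin d) => gaussianReal (inner ℝ v ω) σ2 := by
  have h : Measurable fun ω : EuclideanSpace ℝ (Fin d) => ((inner ℝ v ω : ℝ), σ2) := by fun_prop
  exact measurable_gaussianReal.comp h

/-- The scalar Gaussian experiment: in the state `ω` the signal has the law `N(vᵀ ω, σ2)`. -/
def gaussianExperiment {d : ℕ} (v : EuclideanSpace ℝ (Fin d)) (σ2 : ℝ≥0) :
    Experiment.{0, 0} (EuclideanSpace ℝ (Fin d)) where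
  Signal := ℝ
  kernel := ⟨fun ω => gaussianReal (inner ℝ v ω) σ2, measurable_gaussianReal_inner v σ2⟩
  markov := ⟨fun ω => inferInstanceAs (IsProbabilityMeasure (gaussianReal (inner ℝ v ω) σ2))⟩

/-- The menu with one item for each type `i`: the experiment `N(vᵢᵀ ω, 1 - ‖vᵢ‖²)` at the price
`tᵢ`. (It is used for `‖vᵢ‖ ≤ 1`, where the truncation to `ℝ≥0` has no effect.) -/
def gaussianMenu {d n : ℕ} (v : Fin n → EuclideanSpace ℝ (Fin d)) (t : Fin n → ℝ) :
    Menu.{0, 0, 0} (EuclideanSpace ℝ (Fin d)) where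
  Item := Fin n
  experiment := fun i => gaussianExperiment (v i) (1 - ‖v i‖ ^ 2).toNNReal
  price := t

/-- The constraints of the QCQP in the variables `v` and `t`. -/
structure QCQPFeasible {d n : ℕ} (θ : Fin n → EuclideanSpace ℝ (Fin d))
    (v : Fin n → EuclideanSpace ℝ (Fin d)) (t : Fin n → ℝ) : Prop where
  ic : ∀ i j, (inner ℝ (θ i) (v j)) ^ 2 - t j ≤ (inner ℝ (θ i) (v i)) ^ 2 - t i
  ir : ∀ i, 0 ≤ (inner ℝ (θ i) (v i)) ^ 2 - t i
  norm_le_one : ∀ i, ‖v i‖ ≤ 1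

/-- `(v, t)` is an optimal solution of the QCQP: it is feasible and maximizes `∑ᵢ fᵢ tᵢ` among all
feasible points. -/
def QCQPOptimal {d n : ℕ} (f : Fin n → ℝ) (θ : Fin n → EuclideanSpace ℝ (Fin d))
    (v : Fin n → EuclideanSpace ℝ (Fin d)) (t : Fin n → ℝ) : Prop :=
  QCQPFeasible θ v t ∧
    ∀ (v' : Fin n → EuclideanSpace ℝ (Fin d)) (t' : Fin n → ℝ),
      QCQPFeasible θ v' t' → ∑ i, f i * t' i ≤ ∑ i, f i * t i

end

/-! Under quadratic loss the best action is the posterior mean of `θᵀω`, so an experiment is worth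
`B θ θ - ‖θ‖²` to type `θ`, where `B` is the covariance of the posterior mean of `ω` and `0 ≤ B ≤ I`
(`Experiment.exists_bilin_value`). For `‖v‖ ≤ 1` the Gaussian experiment with noise variance `1 -
‖v‖²` realizes `B = v vᵀ` (`value_gaussianExperiment`), so the QCQP constraints are exactly
incentive compatibility and individual rationality of a Gaussian menu.

Rank one suffices: below any such `B` lies some `v vᵀ` that agrees with it in the direction `θᵢ`
(`exists_inner_sq_le_bilin`). Replacing what type `i` buys by this experiment at the same price
keeps its own net utility and makes the item no more attractive to other types. Hence the purchases
from any menu give a QCQP-feasible point with the same revenue. -/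

/-- The best quadratic prediction of a square integrable random variable is its mean. -/
theorem iSup_integral_neg_sub_sq {Ω : Type*} [MeasurableSpace Ω] {P : Measure Ω}
    [IsProbabilityMeasure P] {X : Ω → ℝ} (hX : Integrable X P)
    (hX2 : Integrable (fun ω => X ω ^ 2) P) :
    ⨆ a : ℝ, ∫ ω, -(X ω - a) ^ 2 ∂P = (∫ ω, X ω ∂P) ^ 2 - ∫ ω, X ω ^ 2 ∂P := by
  have key (a : ℝ) : ∫ ω, -(X ω - a) ^ 2 ∂P
      = (∫ ω, X ω ∂P) ^ 2 - ∫ ω, X ω ^ 2 ∂P - (∫ ω, X ω ∂P - a) ^ 2 := by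
    have h (ω : Ω) : -(X ω - a) ^ 2 = (2 * a) * X ω - X ω ^ 2 - a ^ 2 := by ring
    simp_rw [h]
    rw [integral_sub (by fun_prop) (by fun_prop), integral_sub (by fun_prop) (by fun_prop),
      integral_const_mul]
    simp only [integral_const, probReal_univ, smul_eq_mul]
    ring
  simp_rw [key]
  refine le_antisymm (ciSup_le fun a => by nlinarith [sq_nonneg (∫ ω, X ω ∂P - a)]) ?_
  refine le_ciSup_of_le ⟨(∫ ω, X ω ∂P) ^ 2 - ∫ ω, X ω ^ 2 ∂P, ?_⟩ (∫ ω, X ω ∂P) (by simp)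
  rintro _ ⟨a, rfl⟩
  nlinarith [sq_nonneg (∫ ω, X ω ∂P - a)]

/-! ### Moments of the standard Gaussian -/

section StdGaussian

variable {E : Type*} [NormedAddCommGroup E] [InnerProductSpace ℝ E] [FiniteDimensional ℝ E]
  [MeasurableSpace E] [BorelSpace E]

theorem integrable_norm_sq_stdGaussian : Integrable (fun x : E => ‖x‖ ^ 2) (stdGaussian E) :=
  (IsGaussian.memLp_two_id (μ := stdGaussian E)).integrable_norm_pow two_ne_zero

theorem memLp_inner_stdGaussian (x : E) : MemLp (fun ω : E => inner ℝ x ω) 2 (stdGaussian E) :=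
  (IsGaussian.memLp_two_id (μ := stdGaussian E)).const_inner x

theorem integral_inner_stdGaussian (x : E) : ∫ ω, inner ℝ x ω ∂(stdGaussian E) = 0 := by
  rw [integral_inner IsGaussian.integrable_fun_id, integral_id_stdGaussian, inner_zero_right]

theorem integral_inner_mul_inner_stdGaussian (x y : E) :
    ∫ ω, inner ℝ x ω * inner ℝ y ω ∂(stdGaussian E) = inner ℝ x y := by
  have h := covariance_eq_sub (memLp_inner_stdGaussian x) (memLp_inner_stdGaussian y)
  rw [← covarianceBilin_apply_eq_cov IsGaussian.memLp_two_id, covarianceBilin_stdGaussian,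
    integral_inner_stdGaussian, zero_mul, sub_zero] at h
  exact h.symm

theorem integral_inner_sq_stdGaussian (x : E) :
    ∫ ω, inner ℝ x ω ^ 2 ∂(stdGaussian E) = ‖x‖ ^ 2 := by
  simp_rw [sq, integral_inner_mul_inner_stdGaussian, real_inner_self_eq_norm_mul_norm]

end StdGaussian

/-! ### Value of an arbitrary experiment as a quadratic form in `θ` -/

section Value

variable {d : ℕ}

theorem baselineUtility_quadraticUtility (θ : EuclideanSpace ℝ (Fin d)) :
    baselineUtility (stdGaussian (EuclideanSpace ℝ (Fin d))) (quadraticUtility θ) = -‖θ‖ ^ 2 := by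
  unfold baselineUtility quadraticUtility
  rw [iSup_integral_neg_sub_sq ((memLp_inner_stdGaussian θ).integrable one_le_two)
    (memLp_inner_stdGaussian θ).integrable_sq, integral_inner_stdGaussian,
    integral_inner_sq_stdGaussian]
  ring

/-- The posterior mean of the state after a signal of the experiment. -/
noncomputable def Experiment.posteriorMean (X : Experiment.{0, uS} (EuclideanSpace ℝ (Fin d)))
    (s : X.Signal) : EuclideanSpace ℝ (Fin d) :=
  ∫ ω, ω ∂(posterior X.kernel (stdGaussian (EuclideanSpace ℝ (Fin d))) s)

variable (X : Experiment.{0, uS} (EuclideanSpace ℝ (Fin d)))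

local notation "μ₀" => stdGaussian (EuclideanSpace ℝ (Fin d))

theorem Experiment.bind_posterior :
    ((stdGaussian (EuclideanSpace ℝ (Fin d))).bind X.kernel).bind (posterior X.kernel μ₀)
      = μ₀ := posterior_comp_self

instance Experiment.isProbabilityMeasure_bind :
    IsProbabilityMeasure ((stdGaussian (EuclideanSpace ℝ (Fin d))).bind X.kernel) :=
  inferInstanceAs (IsProbabilityMeasure (X.kernel ∘ₘ μ₀))

instance Experiment.isMarkovKernel_posterior : IsMarkovKernel (posterior X.kernel μ₀) := by
  unfold posterior
  infer_instance

theorem Experiment.ae_integrable_posterior {F : Type*} [NormedAddCommGroup F]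
    {g : EuclideanSpace ℝ (Fin d) → F} (hg : Integrable g μ₀) :
    ∀ᵐ s ∂(μ₀).bind X.kernel, Integrable g (posterior X.kernel μ₀ s) :=
  Measure.ae_integrable_of_integrable_comp (by rwa [X.bind_posterior])

theorem Experiment.integrable_integral_posterior {F : Type*} [NormedAddCommGroup F]
    [NormedSpace ℝ F] {g : EuclideanSpace ℝ (Fin d) → F} (hg : Integrable g μ₀) :
    Integrable (fun s => ∫ ω, g ω ∂(posterior X.kernel μ₀ s)) ((μ₀).bind X.kernel) := by
  rw [← X.bind_posterior, Measure.comp_eq_comp_const_apply] at hg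
  simpa using hg.integral_comp

theorem Experiment.integral_integral_posterior {F : Type*} [NormedAddCommGroup F]
    [NormedSpace ℝ F] {g : EuclideanSpace ℝ (Fin d) → F} (hg : Integrable g μ₀) :
    ∫ s, ∫ ω, g ω ∂(posterior X.kernel μ₀ s) ∂(μ₀).bind X.kernel = ∫ ω, g ω ∂μ₀ := by
  have h := hg
  rw [← X.bind_posterior, Measure.comp_eq_comp_const_apply] at h
  have := Kernel.integral_comp h
  rw [← Measure.comp_eq_comp_const_apply, X.bind_posterior] at this
  simpa using this.symm

theorem Experiment.stronglyMeasurable_posteriorMean : StronglyMeasurable X.posteriorMean :=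
  (stronglyMeasurable_id (α := EuclideanSpace ℝ (Fin d))).integral_kernel

theorem Experiment.integral_posteriorMean : ∫ s, X.posteriorMean s ∂(μ₀).bind X.kernel = 0 := by
  have := X.integral_integral_posterior (IsGaussian.integrable_fun_id (μ := μ₀))
  rwa [integral_id_stdGaussian] at this

theorem Experiment.memLp_posteriorMean : MemLp X.posteriorMean 2 ((μ₀).bind X.kernel) := by
  rw [memLp_two_iff_integrable_sq_norm X.stronglyMeasurable_posteriorMean.aestronglyMeasurable]
  refine (X.integrable_integral_posterior integrable_norm_sq_stdGaussian).mono'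
    (X.stronglyMeasurable_posteriorMean.norm.pow 2).aestronglyMeasurable ?_
  filter_upwards [X.ae_integrable_posterior integrable_norm_sq_stdGaussian,
    X.ae_integrable_posterior (IsGaussian.integrable_fun_id (μ := μ₀))] with s h2 h1
  -- Jensen for the convex function `‖·‖²` under the posterior.
  rw [Real.norm_of_nonneg (by positivity)]
  exact ((convexOn_univ_norm (E := EuclideanSpace ℝ (Fin d))).pow (fun _ _ => norm_nonneg _)
    2).map_integral_le (by fun_prop) isClosed_univ (by simp) h1 h2

theorem Experiment.value_quadraticUtility (θ : EuclideanSpace ℝ (Fin d)) :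
    X.value μ₀ (quadraticUtility θ)
      = ∫ s, inner ℝ θ (X.posteriorMean s) ^ 2 ∂((μ₀).bind X.kernel) - ‖θ‖ ^ 2 := by
  have hsq : Integrable (fun ω => inner ℝ θ ω ^ 2) μ₀ := (memLp_inner_stdGaussian θ).integrable_sq
  rw [← integral_inner_sq_stdGaussian, ← X.integral_integral_posterior hsq,
    ← integral_sub (X.memLp_posteriorMean.const_inner θ).integrable_sq
      (X.integrable_integral_posterior hsq)]
  refine integral_congr_ae ?_
  filter_upwards [X.ae_integrable_posterior hsq,
    X.ae_integrable_posterior (IsGaussian.integrable_fun_id (μ := μ₀))] with s h2 h1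
  unfold quadraticUtility
  rw [iSup_integral_neg_sub_sq (h1.const_inner θ) h2, integral_inner h1]
  rfl

/-- The loss is never negative. No integrability is needed, as an undefined integral is `0`. This is
the source of the bound `B ≤ I`. -/
theorem Experiment.value_quadraticUtility_nonpos (θ : EuclideanSpace ℝ (Fin d)) :
    X.value μ₀ (quadraticUtility θ) ≤ 0 :=
  integral_nonpos fun _ => Real.iSup_nonpos fun _ => integral_nonpos fun _ =>
    neg_nonpos.2 (sq_nonneg _)

/-- `B` is the covariance form of the law of the posterior mean, which is centred because the prior
is. -/
theorem Experiment.exists_bilin_value :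
    ∃ B : EuclideanSpace ℝ (Fin d) →L[ℝ] EuclideanSpace ℝ (Fin d) →L[ℝ] ℝ,
      B.toBilinForm.IsPosSemidef ∧ (∀ x, B x x ≤ ‖x‖ ^ 2) ∧
      ∀ θ, X.value μ₀ (quadraticUtility θ) = B θ θ - ‖θ‖ ^ 2 := by
  have hm : AEMeasurable X.posteriorMean ((μ₀).bind X.kernel) :=
    X.stronglyMeasurable_posteriorMean.measurable.aemeasurable
  have hL : MemLp id 2 (((μ₀).bind X.kernel).map X.posteriorMean) := by
    rw [memLp_map_measure_iff (by fun_prop) hm]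
    exact X.memLp_posteriorMean
  have key (θ) : X.value μ₀ (quadraticUtility θ)
      = covarianceBilin (((μ₀).bind X.kernel).map X.posteriorMean) θ θ - ‖θ‖ ^ 2 := by
    rw [X.value_quadraticUtility, covarianceBilin_apply hL, integral_map hm (by fun_prop),
      integral_map hm (by fun_prop)]
    simp [X.integral_posteriorMean, sq]
  refine ⟨_, isPosSemidef_covarianceBilin, fun x => ?_, key⟩
  have := key x ▸ X.value_quadraticUtility_nonpos x
  linarith

end Value

/-- A positive semidefinite form below the identity is bounded below by the square of a linear form
of norm at most one, with equality in a given direction. -/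
theorem exists_inner_sq_le_bilin {E : Type*} [NormedAddCommGroup E] [InnerProductSpace ℝ E]
    [CompleteSpace E] {B : E →L[ℝ] E →L[ℝ] ℝ} (hB : B.toBilinForm.IsPosSemidef)
    (hB1 : ∀ x, B x x ≤ ‖x‖ ^ 2) (θ : E) :
    ∃ v : E, ‖v‖ ≤ 1 ∧ inner ℝ θ v ^ 2 = B θ θ ∧ ∀ x, inner ℝ x v ^ 2 ≤ B x x := by
  have h0 (x : E) : 0 ≤ B x x := hB.nonneg x
  have hcs (x y : E) : B x y ^ 2 ≤ B x x * B y y :=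
    B.toBilinForm.apply_sq_le_of_symm hB.nonneg ⟨hB.eq⟩ x y
  -- If `B θ θ = 0`, then `v = 0` works. Otherwise `v = Bθ / √(B θ θ)`, and `v vᵀ ≤ B` is
  -- Cauchy–Schwarz for `B`.
  rcases (h0 θ).eq_or_lt with h | h
  · exact ⟨0, by simp, by simp [← h], fun x => by simpa using h0 x⟩
  have hr2 : √(B θ θ) ^ 2 = B θ θ := Real.sq_sqrt h.le
  set v : E := (√(B θ θ))⁻¹ • (InnerProductSpace.toDual ℝ E).symm (B θ) with hv
  have hin (x : E) : inner ℝ x v ^ 2 = B θ x ^ 2 / B θ θ := by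
    rw [hv, real_inner_smul_right, real_inner_comm, InnerProductSpace.toDual_symm_apply, mul_pow,
      inv_pow, hr2]
    ring
  have hle (x : E) : inner ℝ x v ^ 2 ≤ B x x := by
    rw [hin, div_le_iff₀ h, mul_comm]
    exact hcs θ x
  refine ⟨v, ?_, by rw [hin]; field_simp, hle⟩
  -- Testing `v vᵀ ≤ B ≤ I` at `v` itself gives `‖v‖⁴ ≤ ‖v‖²`.
  by_contra! hlt
  have := (hle v).trans (hB1 v)
  rw [real_inner_self_eq_norm_sq] at this
  have h1 : 1 < ‖v‖ ^ 2 := by nlinarith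
  nlinarith

/-! ### Value of the scalar Gaussian experiment -/

section Gaussian

/-- A kernel driven by independent noise has an explicit joint law. It is used both for the signal
given the state and for the state given the signal. -/
theorem compProd_eq_map_prod {A B C : Type*} [MeasurableSpace A] [MeasurableSpace B]
    [MeasurableSpace C] {μ : Measure A} {ρ : Measure B} [SFinite μ] [SFinite ρ]
    {κ : Kernel A C} [IsSFiniteKernel κ] {F : A × B → C} (hF : Measurable F)
    (hκ : ∀ a, κ a = ρ.map fun b => F (a, b)) :
    μ ⊗ₘ κ = (μ.prod ρ).map fun p => (p.1, F p) := by
  refine Measure.ext_of_lintegral _ fun g hg => ?_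
  rw [Measure.lintegral_compProd hg, lintegral_map hg (by fun_prop),
    lintegral_prod _ (by fun_prop)]
  refine lintegral_congr fun a => ?_
  rw [hκ, lintegral_map (by fun_prop) (by fun_prop)]

variable {d : ℕ}

local notation "μ₀" => stdGaussian (EuclideanSpace ℝ (Fin d))

/-- The signal `vᵀ ω + z` of the scalar Gaussian experiment, from the state and the noise. -/
noncomputable def gaussianSignal (v : EuclideanSpace ℝ (Fin d)) (p : EuclideanSpace ℝ (Fin d) × ℝ) :
    ℝ := inner ℝ v p.1 + p.2

/-- The part of the state not explained by the signal of the scalar Gaussian experiment. -/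
noncomputable def gaussianResidual (v : EuclideanSpace ℝ (Fin d))
    (p : EuclideanSpace ℝ (Fin d) × ℝ) : EuclideanSpace ℝ (Fin d) :=
  p.1 - gaussianSignal v p • v

@[fun_prop]
theorem continuous_gaussianSignal (v : EuclideanSpace ℝ (Fin d)) :
    Continuous (gaussianSignal v) := by
  unfold gaussianSignal; fun_prop

@[fun_prop]
theorem continuous_gaussianResidual (v : EuclideanSpace ℝ (Fin d)) :
    Continuous (gaussianResidual v) := by
  unfold gaussianResidual; fun_prop

variable (v : EuclideanSpace ℝ (Fin d)) (σ2 : ℝ≥0)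

theorem memLp_inner_fst (x : EuclideanSpace ℝ (Fin d)) :
    MemLp (fun p : EuclideanSpace ℝ (Fin d) × ℝ => (inner ℝ x p.1 : ℝ)) 2
      ((μ₀).prod (gaussianReal 0 σ2)) :=
  (memLp_inner_stdGaussian x).comp_fst _

theorem memLp_noise :
    MemLp (fun p : EuclideanSpace ℝ (Fin d) × ℝ => p.2) 2 ((μ₀).prod (gaussianReal 0 σ2)) :=
  (memLp_id_gaussianReal 2).comp_snd _

theorem memLp_gaussianSignal :
    MemLp (gaussianSignal v) 2 ((μ₀).prod (gaussianReal 0 σ2)) :=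
  (memLp_inner_fst σ2 v).add (memLp_noise σ2)

variable {σ2} in
theorem integrable_inner_mul {g : EuclideanSpace ℝ (Fin d) × ℝ → ℝ}
    (hg : MemLp g 2 ((μ₀).prod (gaussianReal 0 σ2))) (x : EuclideanSpace ℝ (Fin d)) :
    Integrable (fun p => inner ℝ x p.1 * g p) ((μ₀).prod (gaussianReal 0 σ2)) :=
  (memLp_inner_fst σ2 x).integrable_mul hg

theorem integral_inner_fst (x : EuclideanSpace ℝ (Fin d)) :
    ∫ p, inner ℝ x p.1 ∂((μ₀).prod (gaussianReal 0 σ2)) = 0 := by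
  have := integral_prod_mul (μ := μ₀) (ν := gaussianReal 0 σ2) (fun ω => (inner ℝ x ω : ℝ))
    (fun _ => (1 : ℝ))
  simpa [integral_inner_stdGaussian] using this

theorem integral_noise :
    ∫ p, p.2 ∂((μ₀).prod (gaussianReal 0 σ2)) = 0 := by
  have := integral_prod_mul (μ := μ₀) (ν := gaussianReal 0 σ2) (fun _ => (1 : ℝ)) (fun z => z)
  simpa using this

theorem integral_gaussianSignal :
    ∫ p, gaussianSignal v p ∂((μ₀).prod (gaussianReal 0 σ2)) = 0 := by
  unfold gaussianSignal
  rw [integral_add ((memLp_inner_fst σ2 v).integrable one_le_two)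
    ((memLp_noise σ2).integrable one_le_two), integral_inner_fst, integral_noise, add_zero]

theorem integral_inner_mul_inner_fst (x y : EuclideanSpace ℝ (Fin d)) :
    ∫ p, inner ℝ x p.1 * inner ℝ y p.1 ∂((μ₀).prod (gaussianReal 0 σ2)) = inner ℝ x y := by
  have := integral_prod_mul (μ := μ₀) (ν := gaussianReal 0 σ2)
    (fun ω => (inner ℝ x ω * inner ℝ y ω : ℝ)) (fun _ => (1 : ℝ))
  simpa [integral_inner_mul_inner_stdGaussian] using this

theorem integral_inner_mul_noise (x : EuclideanSpace ℝ (Fin d)) :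
    ∫ p, inner ℝ x p.1 * p.2 ∂((μ₀).prod (gaussianReal 0 σ2)) = 0 := by
  have := integral_prod_mul (μ := μ₀) (ν := gaussianReal 0 σ2) (fun ω => (inner ℝ x ω : ℝ))
    (fun z => z)
  simpa [integral_inner_stdGaussian] using this

theorem integral_noise_sq :
    ∫ p, p.2 ^ 2 ∂((μ₀).prod (gaussianReal 0 σ2)) = σ2 := by
  have := integral_prod_mul (μ := μ₀) (ν := gaussianReal 0 σ2) (fun _ => (1 : ℝ)) (fun z => z ^ 2)
  have h2 := variance_eq_sub (memLp_id_gaussianReal (μ := 0) (v := σ2) 2)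
  simp only [variance_id_gaussianReal, Pi.pow_apply, id_eq, integral_id_gaussianReal] at h2
  simp only [one_mul, integral_const, probReal_univ, smul_eq_mul] at this
  linarith

theorem integral_inner_mul_gaussianSignal (x : EuclideanSpace ℝ (Fin d)) :
    ∫ p, inner ℝ x p.1 * gaussianSignal v p ∂((μ₀).prod (gaussianReal 0 σ2)) = inner ℝ x v := by
  simp_rw [gaussianSignal, mul_add]
  rw [integral_add (integrable_inner_mul (memLp_inner_fst σ2 v) x)
    (integrable_inner_mul (memLp_noise σ2) x), integral_inner_mul_inner_fst,
    integral_inner_mul_noise, add_zero]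

theorem integral_gaussianSignal_sq :
    ∫ p, gaussianSignal v p ^ 2 ∂((μ₀).prod (gaussianReal 0 σ2)) = ‖v‖ ^ 2 + σ2 := by
  have h (p : EuclideanSpace ℝ (Fin d) × ℝ) : gaussianSignal v p ^ 2
      = inner ℝ v p.1 * gaussianSignal v p + inner ℝ v p.1 * p.2 + p.2 ^ 2 := by
    unfold gaussianSignal; ring
  simp_rw [h]
  have h1 := integrable_inner_mul (memLp_gaussianSignal v σ2) v
  have h2 := integrable_inner_mul (memLp_noise σ2) v
  rw [integral_add (h1.fun_add h2) (memLp_noise σ2).integrable_sq, integral_add h1 h2,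
    integral_inner_mul_gaussianSignal, integral_inner_mul_noise, integral_noise_sq,
    real_inner_self_eq_norm_sq, add_zero]

theorem hasGaussianLaw_gaussianSignal_gaussianResidual :
    HasGaussianLaw (fun p => (gaussianSignal v p, gaussianResidual v p))
      ((μ₀).prod (gaussianReal 0 σ2)) := by
  let S : EuclideanSpace ℝ (Fin d) × ℝ →L[ℝ] ℝ :=
    (innerSL ℝ v).comp (ContinuousLinearMap.fst ℝ _ _) + ContinuousLinearMap.snd ℝ _ _
  exact (IsGaussian.hasGaussianLaw_id (μ := (μ₀).prod (gaussianReal 0 σ2))).map_fun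
    (S.prod (ContinuousLinearMap.fst ℝ _ _ - S.smulRight v))

theorem integral_inner_gaussianResidual (x : EuclideanSpace ℝ (Fin d)) :
    ∫ p, inner ℝ x (gaussianResidual v p) ∂((μ₀).prod (gaussianReal 0 σ2)) = 0 := by
  simp_rw [gaussianResidual, inner_sub_right, real_inner_smul_right]
  rw [integral_sub ((memLp_inner_fst σ2 x).integrable one_le_two)
    (((memLp_gaussianSignal v σ2).integrable one_le_two).mul_const _), integral_mul_const,
    integral_inner_fst, integral_gaussianSignal]
  ring

variable {v σ2}

/-- Jointly Gaussian variables are independent once uncorrelated. The covariance of the signal with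
`xᵀ(residual)` is `xᵀv - xᵀv (‖v‖² + σ2)`, which vanishes because the signal has unit variance. -/
theorem indepFun_gaussianSignal_gaussianResidual (h : ‖v‖ ^ 2 + σ2 = 1) :
    IndepFun (gaussianSignal v) (gaussianResidual v) ((μ₀).prod (gaussianReal 0 σ2)) := by
  refine (hasGaussianLaw_gaussianSignal_gaussianResidual v σ2).indepFun_of_covariance_inner
    fun c x => ?_
  have hS := memLp_gaussianSignal v σ2
  have hX : MemLp (fun p => inner ℝ x (gaussianResidual v p)) 2
      ((μ₀).prod (gaussianReal 0 σ2)) :=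
    (hasGaussianLaw_gaussianSignal_gaussianResidual v σ2).snd.memLp_two.const_inner x
  rw [covariance_eq_sub (hS.const_inner c) hX, integral_inner_gaussianResidual, mul_zero, sub_zero]
  have hp (p : EuclideanSpace ℝ (Fin d) × ℝ) :
      inner ℝ c (gaussianSignal v p) * inner ℝ x (gaussianResidual v p)
      = c * (inner ℝ x p.1 * gaussianSignal v p) - c * inner ℝ x v * gaussianSignal v p ^ 2 := by
    simp only [gaussianResidual, inner_sub_right, real_inner_smul_right, RCLike.inner_apply,
      conj_trivial]
    ring
  simp_rw [Pi.mul_apply, hp]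
  rw [integral_sub ((integrable_inner_mul hS x).const_mul c)
    (hS.integrable_sq.const_mul _), integral_const_mul, integral_const_mul,
    integral_inner_mul_gaussianSignal, integral_gaussianSignal_sq, h]
  ring

variable (v σ2) in
/-- The kernel of the scalar Gaussian experiment, with the real line as its space of signals. -/
noncomputable def gaussianKernel : Kernel (EuclideanSpace ℝ (Fin d)) ℝ :=
  (gaussianExperiment v σ2).kernel

instance isMarkovKernel_gaussianKernel : IsMarkovKernel (gaussianKernel v σ2) :=
  (gaussianExperiment v σ2).markov

theorem compProd_gaussianKernel :
    μ₀ ⊗ₘ gaussianKernel v σ2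
      = ((μ₀).prod (gaussianReal 0 σ2)).map fun p => (p.1, gaussianSignal v p) := by
  refine compProd_eq_map_prod (by fun_prop) fun ω => ?_
  simp only [gaussianSignal, gaussianReal_map_const_add, zero_add]
  rfl

theorem bind_gaussianKernel :
    (μ₀).bind (gaussianKernel v σ2)
      = ((μ₀).prod (gaussianReal 0 σ2)).map (gaussianSignal v) := by
  rw [← Measure.snd_compProd, compProd_gaussianKernel, Measure.snd]
  exact Measure.map_map measurable_snd (by fun_prop)

/-- The state is `s • v` plus a centred residual independent of the signal `s`, so the posterior is
the law of the residual translated by `s • v`. -/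
theorem posteriorMean_gaussianKernel (h : ‖v‖ ^ 2 + σ2 = 1) :
    ∀ᵐ s ∂(μ₀).bind (gaussianKernel v σ2),
      ∫ ω, ω ∂(posterior (gaussianKernel v σ2) μ₀ s) = s • v := by
  set P := (μ₀).prod (gaussianReal 0 σ2)
  set ρ := P.map (gaussianResidual v) with hρ
  have hρP : IsProbabilityMeasure ρ := Measure.isProbabilityMeasure_map (by fun_prop)
  -- The candidate posterior; uniqueness of disintegrations identifies it almost everywhere.
  let η : Kernel ℝ (EuclideanSpace ℝ (Fin d)) :=
    (Kernel.id ×ₖ Kernel.const ℝ ρ).map fun p => p.2 + p.1 • v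
  have hη (s : ℝ) : η s = ρ.map fun x => x + s • v := by
    rw [Kernel.map_apply _ (by fun_prop), Kernel.prod_apply, Kernel.id_apply, Kernel.const_apply,
      Measure.dirac_prod, Measure.map_map (by fun_prop) (by fun_prop)]
    rfl
  have hηM : IsMarkovKernel η := Kernel.IsMarkovKernel.map _ (by fun_prop)
  have hpost : η =ᵐ[(μ₀).bind (gaussianKernel v σ2)]
      posterior (gaussianKernel v σ2) μ₀ := by
    refine ae_eq_posterior_of_compProd_eq ?_
    rw [compProd_gaussianKernel, bind_gaussianKernel]
    rw [compProd_eq_map_prod (ρ := ρ) (F := fun p => p.2 + p.1 • v) (by fun_prop) hη,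
      ← (indepFun_iff_map_prod_eq_prod_map_map (by fun_prop) (by fun_prop)).1
        (indepFun_gaussianSignal_gaussianResidual h),
      Measure.map_map (by fun_prop) (by fun_prop), Measure.map_map (by fun_prop) (by fun_prop)]
    congr 1
    ext p : 1
    simp [gaussianResidual]
  have hint : Integrable (gaussianResidual v) P :=
    (hasGaussianLaw_gaussianSignal_gaussianResidual v σ2).snd.integrable
  have hmean : ∫ p, gaussianResidual v p ∂P = 0 := by
    refine integral_eq_zero_of_forall_integral_inner_eq_zero ℝ _ hint fun x => ?_
    exact integral_inner_gaussianResidual v σ2 x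
  filter_upwards [hpost] with s hs
  rw [← hs, hη, integral_map (by fun_prop) (by fun_prop), hρ,
    integral_map (by fun_prop) (by fun_prop), integral_add hint (integrable_const _), hmean]
  simp

theorem value_gaussianExperiment (h : ‖v‖ ^ 2 + σ2 = 1) (θ : EuclideanSpace ℝ (Fin d)) :
    (gaussianExperiment v σ2).value μ₀ (quadraticUtility θ) = inner ℝ θ v ^ 2 - ‖θ‖ ^ 2 := by
  have h1 : (gaussianExperiment v σ2).value μ₀ (quadraticUtility θ)
      = ∫ s, inner ℝ θ (∫ ω, ω ∂(posterior (gaussianKernel v σ2) μ₀ s)) ^ 2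
        ∂(μ₀).bind (gaussianKernel v σ2) - ‖θ‖ ^ 2 :=
    Experiment.value_quadraticUtility _ θ
  have h2 : ∫ s, inner ℝ θ (∫ ω, ω ∂(posterior (gaussianKernel v σ2) μ₀ s)) ^ 2
      ∂(μ₀).bind (gaussianKernel v σ2)
      = ∫ s, s ^ 2 * inner ℝ θ v ^ 2 ∂(μ₀).bind (gaussianKernel v σ2) := by
    refine integral_congr_ae ?_
    filter_upwards [posteriorMean_gaussianKernel h] with s hs
    rw [hs, real_inner_smul_right, mul_pow]
  rw [h1, h2, bind_gaussianKernel, integral_map (by fun_prop) (by fun_prop), integral_mul_const,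
    integral_gaussianSignal_sq, h, one_mul]

end Gaussian

/-! ### From menus to the QCQP and back -/

section QCQP

variable {d n : ℕ} {f : Fin n → ℝ} {θ v : Fin n → EuclideanSpace ℝ (Fin d)} {t : Fin n → ℝ}

/-- Raising all prices by the same amount is feasible as long as every type keeps a nonnegative
net utility, so that no price is negative at an optimum. -/
theorem QCQPOptimal.price_nonneg (hf_sum : ∑ i, f i = 1) (hopt : QCQPOptimal f θ v t)
    (i : Fin n) : 0 ≤ t i := by
  by_contra! hi
  have hfeas : QCQPFeasible θ v fun j => t j - t i := by
    refine ⟨fun j k => ?_, fun j => ?_, hopt.1.norm_le_one⟩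
    · linarith [hopt.1.ic j k]
    -- Type `j` weakly prefers its item to item `i`, whose shifted price is `0` and whose gross gain
    -- is a square.
    · nlinarith [hopt.1.ic j i, sq_nonneg (inner ℝ (θ j) (v i) : ℝ)]
  have := hopt.2 _ _ hfeas
  simp only [mul_sub, Finset.sum_sub_distrib, ← Finset.sum_mul, hf_sum, one_mul] at this
  linarith

theorem Menu.netUtility_gaussianMenu (hv : ∀ i, ‖v i‖ ≤ 1) (i j : Fin n) :
    (gaussianMenu v t).netUtility (stdGaussian (EuclideanSpace ℝ (Fin d)))
      (quadraticUtility (θ i)) (some j) = inner ℝ (θ i) (v j) ^ 2 - ‖θ i‖ ^ 2 - t j := by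
  have h : ‖v j‖ ^ 2 + ((1 - ‖v j‖ ^ 2).toNNReal : ℝ) = 1 := by
    rw [Real.coe_toNNReal _ (by nlinarith [hv j, norm_nonneg (v j)])]
    ring
  change (gaussianExperiment (v j) _).value _ _ - t j = _
  rw [value_gaussianExperiment h]

theorem Menu.IsOptimalPurchase.of_qcqpFeasible (h : QCQPFeasible θ v t) :
    (gaussianMenu v t).IsOptimalPurchase (stdGaussian (EuclideanSpace ℝ (Fin d)))
      (fun i => quadraticUtility (θ i)) fun i => some i := by
  rintro i (_ | j)
  · rw [netUtility_gaussianMenu h.norm_le_one]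
    change baselineUtility _ _ ≤ _
    rw [baselineUtility_quadraticUtility]
    linarith [h.ir i]
  · rw [netUtility_gaussianMenu h.norm_le_one]
    erw [netUtility_gaussianMenu h.norm_le_one]
    linarith [h.ic i j]

/-- Every option of a menu is matched, at the same payment, by a vector of the unit ball whose
scalar Gaussian experiment is as good for the given type and no better for the others. -/
theorem Menu.exists_inner_sq_le_netUtility (M : Menu.{0, uS, uK} (EuclideanSpace ℝ (Fin d)))
    (θ₀ : EuclideanSpace ℝ (Fin d)) (o : Option M.Item) :
    ∃ w : EuclideanSpace ℝ (Fin d), ‖w‖ ≤ 1 ∧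
      M.netUtility (stdGaussian _) (quadraticUtility θ₀) o
        = inner ℝ θ₀ w ^ 2 - ‖θ₀‖ ^ 2 - M.payment o ∧
      ∀ x, inner ℝ x w ^ 2 - ‖x‖ ^ 2 - M.payment o
        ≤ M.netUtility (stdGaussian _) (quadraticUtility x) o := by
  cases o with
  | none =>
    refine ⟨0, by simp, ?_, fun x => ?_⟩ <;>
      simp [Menu.netUtility, Menu.payment, baselineUtility_quadraticUtility]
  | some k =>
    obtain ⟨B, hB, hB1, hval⟩ := (M.experiment k).exists_bilin_value
    obtain ⟨w, hw, heq, hle⟩ := exists_inner_sq_le_bilin hB hB1 θ₀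
    refine ⟨w, hw, ?_, fun x => ?_⟩
    · simp only [Menu.netUtility, Menu.payment, hval, heq]
    · simp only [Menu.netUtility, Menu.payment, hval]
      linarith [hle x]

/-- Each purchase is replaced by the rank-one experiment tailored to its buyer: equality on the
buyer's own side and inequality on the deviator's side preserve every constraint, with unchanged
payments. -/
theorem Menu.IsOptimalPurchase.exists_qcqpFeasible
    {M : Menu.{0, uS, uK} (EuclideanSpace ℝ (Fin d))} {c : Fin n → Option M.Item}
    (h : M.IsOptimalPurchase (stdGaussian _) (fun i => quadraticUtility (θ i)) c) :
    ∃ w, QCQPFeasible θ w fun i => M.payment (c i) := by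
  choose w hw heq hle using fun i => M.exists_inner_sq_le_netUtility (θ i) (c i)
  refine ⟨w, fun i j => ?_, fun i => ?_, hw⟩
  · linarith [h i (c j), heq i, hle j (θ i)]
  · have h0 : M.netUtility (stdGaussian _) (quadraticUtility (θ i)) none = -‖θ i‖ ^ 2 :=
      baselineUtility_quadraticUtility (θ i)
    linarith [h i none, heq i]

end QCQP

theorem proposition3 {d n : ℕ} (f : Fin n → ℝ) (hf : ∀ i, 0 ≤ f i) (hf_sum : ∑ i, f i = 1)
    (θ : Fin n → EuclideanSpace ℝ (Fin d))
    (v : Fin n → EuclideanSpace ℝ (Fin d)) (t : Fin n → ℝ) (hopt : QCQPOptimal f θ v t) :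
    (∀ i, 0 ≤ t i) ∧
      Menu.IsRevenueMaximizing.{0, 0, 0, 0, uS, uK} (gaussianMenu v t)
        (stdGaussian (EuclideanSpace ℝ (Fin d))) f (fun i => quadraticUtility (θ i))
        (fun i => some i) := by
  refine ⟨hopt.price_nonneg hf_sum, .of_qcqpFeasible hopt.1, fun M' c' h => ?_⟩
  obtain ⟨w, hw⟩ := h.exists_qcqpFeasible
  exact hopt.2 _ _ hw
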